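/- Let $\mathbb{K}$ be a field of any characteristic, let $0<v<n$ be integers and let $R=\mathbb{K}[x_1,\ldots,x_n]$ be the standard graded polynomial ring. Let $f_1,\ldots,f_m\in R$ $(m\ge 0)$ be a homogeneous system of quadratic Oil and Vinegar equations with vinegar variables $x_1,\ldots,x_v$; that is, each $f_k$ is homogeneous of degree $2$ (the zero polynomial being allowed) and of the form $$\sum_{i=1}^n\sum_{j=1}^v \alpha_{i,j}\,x_ix_j+\sum_{i=1}^n\beta_i x_i+\gamma ,\qquad \alpha_{i,j},\beta_i,\gamma\in\mathbb{K}.$$ Put $\mathcal{F}=(f_1,\ldots,f_m)$ and $\mathcal{V}=(x_1,\ldots,x_v)$, so that $\mathcal{F}\subseteq\mathcal{V}$. For $M=R/\mathcal{F}$ and for $M=\mathcal{V}/\mathcal{F}$, with the grading induced from $R$, let $H_M:\mathbb{N}\to\mathbb{N}$, $H_M(d)=\dim_{\mathbb{K}}M_d$, be the Hilbert function. Each of these two functions agrees for all large $d$ with a (unique) polynomial $\mathrm{HP}_M\in\mathbb{Q}[t]$, the Hilbert polynomial; let the index of regularity $i_{\mathrm{reg}}(M)$ be the least $d\in\mathbb{N}$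 such that $H_M(e)=\mathrm{HP}_M(e)$ for all $e\ge d$. Then $$i_{\mathrm{reg}}(R/\mathcal{F})=i_{\mathrm{reg}}(\mathcal{V}/\mathcal{F}).$$ -/

import Mathlib

open MvPolynomial

/-- `p` is an Oil and Vinegar polynomial in `x_1, …, x_n` whose vinegar variables are the first `v`
variables: `p = ∑_{i ≤ n} ∑_{j ≤ v} α_{ij} x_i x_j + ∑_{i ≤ n} β_i x_i + γ`. -/
def IsOVPolynomial {K : Type*} [Field K] {n : ℕ} (v : ℕ) (p : MvPolynomial (Fin n) K) : Prop :=
  ∃ (α : Fin n → Fin n → K) (β : Fin n → K) (γ : K),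
    p = (∑ i, ∑ j with j.val < v, C (α i j) * X i * X j) + (∑ i, C (β i) * X i) + C γ

/-- A homogeneous system of `m` quadratic OV-equations with `v` vinegar variables. -/
def IsHomogeneousOVSystem {K : Type*} [Field K] {n m : ℕ} (v : ℕ)
    (f : Fin m → MvPolynomial (Fin n) K) : Prop :=
  ∀ k, IsOVPolynomial v (f k) ∧ (f k).IsHomogeneous 2

/-- The ideal generated by a system of polynomials. -/
noncomputable def systemIdeal {K : Type*} [Field K] {n m : ℕ} (f : Fin m → MvPolynomial (Fin n) K) :
    Ideal (MvPolynomial (Fin n) K) :=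
  Ideal.span (Set.range f)

/-- The ideal generated by the vinegar variables `x_1, …, x_v`. -/
noncomputable def vinegarIdeal (K : Type*) [Field K] (n v : ℕ) : Ideal (MvPolynomial (Fin n) K) :=
  Ideal.span {p | ∃ j : Fin n, j.val < v ∧ p = X j}

/-- The degree-`d` component `(R/I)_d` of `R/I`: the image of the forms of degree `d`. -/
noncomputable def quotientComponent {K : Type*} [Field K] {n : ℕ}
    (I : Ideal (MvPolynomial (Fin n) K)) (d : ℕ) : Submodule K (MvPolynomial (Fin n) K ⧸ I) :=
  (homogeneousSubmodule (Fin n) K d).map (Ideal.Quotient.mkₐ K I).toLinearMap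

/-- The degree-`d` component `(J/I)_d` of the `R`-module `J/I`, for ideals `I ⊆ J`: the image of
the forms of degree `d` that lie in `J`. -/
noncomputable def subquotientComponent {K : Type*} [Field K] {n : ℕ}
    (J I : Ideal (MvPolynomial (Fin n) K)) (d : ℕ) : Submodule K (J ⧸ I.submoduleOf J) :=
  ((homogeneousSubmodule (Fin n) K d).comap (J.subtype.restrictScalars K)).map
    ((I.submoduleOf J).mkQ.restrictScalars K)

/-- The Hilbert function of `R/I`. -/
noncomputable def hilbertFunctionQuotient {K : Type*} [Field K] {n : ℕ}
    (I : Ideal (MvPolynomial (Fin n) K)) (d : ℕ) : ℕ :=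
  Module.finrank K (quotientComponent I d)

/-- The Hilbert function of `J/I`, for ideals `I ⊆ J`. -/
noncomputable def hilbertFunctionSubquotient {K : Type*} [Field K] {n : ℕ}
    (J I : Ideal (MvPolynomial (Fin n) K)) (d : ℕ) : ℕ :=
  Module.finrank K (subquotientComponent J I d)

/-- `P` is the Hilbert polynomial of a Hilbert function `H`: `H d = P d` for all large `d`.
There is at most one such `P`. -/
def IsHilbertPolynomial (H : ℕ → ℕ) (P : Polynomial ℚ) : Prop :=
  ∀ᶠ d in Filter.atTop, (H d : ℚ) = P.eval (d : ℚ)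

/-- The index of regularity of a Hilbert function `H` that has a Hilbert polynomial: the least
`d` in `ℕ` from which on `H` agrees with its Hilbert polynomial. -/
noncomputable def indexOfRegularity (H : ℕ → ℕ) : ℕ :=
  sInf {d | ∃ P, IsHilbertPolynomial H P ∧ ∀ e, d ≤ e → (H e : ℚ) = P.eval (e : ℚ)}

open Filter Finset in
theorem exists_polynomial_eval_eq_sum_range (P : Polynomial ℚ) :
    ∃ Q : Polynomial ℚ, ∀ d : ℕ, Q.eval (d : ℚ) = ∑ i ∈ range d, P.eval (i : ℚ) := by
  induction P using Polynomial.induction_on' with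
  | add p q hp hq =>
    obtain ⟨P, hP⟩ := hp
    obtain ⟨Q, hQ⟩ := hq
    exact ⟨P + Q, fun d => by simp [hP, hQ, sum_add_distrib]⟩
  | monomial k c =>
    refine ⟨Polynomial.C (c / (k + 1)) *
      (Polynomial.bernoulli (k + 1) - Polynomial.C (bernoulli (k + 1))), fun d => ?_⟩
    have hk : (k + 1 : ℚ) ≠ 0 := by positivity
    have := Polynomial.sum_range_pow_eq_bernoulli_sub d k
    simp only [Nat.succ_eq_add_one] at this
    simp only [Polynomial.eval_mul, Polynomial.eval_C, Polynomial.eval_sub, ← this,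
      Polynomial.eval_monomial, ← mul_sum]
    field_simp

open Filter Finset in
/-- The partial sums of an eventually polynomial function are eventually polynomial. -/
theorem exists_polynomial_eventually_eq_sum_range {g : ℕ → ℚ} {P : Polynomial ℚ}
    (h : ∀ᶠ d : ℕ in atTop, g d = P.eval (d : ℚ)) :
    ∃ Q : Polynomial ℚ, ∀ᶠ d : ℕ in atTop, ∑ i ∈ range d, g i = Q.eval (d : ℚ) := by
  obtain ⟨N, hN⟩ := eventually_atTop.1 h
  obtain ⟨Q, hQ⟩ := exists_polynomial_eval_eq_sum_range P
  refine ⟨Q + Polynomial.C (∑ i ∈ range N, (g i - P.eval (i : ℚ))),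
    eventually_atTop.2 ⟨N, fun d hd => ?_⟩⟩
  have hs : ∑ i ∈ range d, (g i - P.eval (i : ℚ)) = ∑ i ∈ range N, (g i - P.eval (i : ℚ)) := by
    refine (sum_subset (range_mono hd) fun i _ hi => ?_).symm
    rw [hN i (by simpa using hi), sub_self]
  rw [Polynomial.eval_add, Polynomial.eval_C, hQ, ← hs, ← sum_add_distrib]
  simp

open Filter in
theorem exists_polynomial_eventually_eq_shift {g : ℕ → ℚ} {P : Polynomial ℚ}
    (h : ∀ᶠ d : ℕ in atTop, g d = P.eval (d : ℚ)) (k : ℕ) :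
    ∃ Q : Polynomial ℚ, ∀ᶠ d : ℕ in atTop, g (d - k) = Q.eval (d : ℚ) := by
  refine ⟨P.comp (Polynomial.X - Polynomial.C (k : ℚ)), ?_⟩
  filter_upwards [(tendsto_sub_atTop_nat k).eventually h, eventually_ge_atTop k] with d hd hk
  rw [hd, Nat.cast_sub hk]
  simp

/-- An increasing sequence of upper sets in a well-quasi-order is eventually constant. -/
theorem exists_forall_ge_eq_of_isUpperSet {α : Type*} [Preorder α] [WellQuasiOrderedLE α]
    {U : ℕ → Set α} (hU : ∀ k, IsUpperSet (U k)) (hmono : Monotone U) :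
    ∃ N, ∀ k, N ≤ k → U k = U N := by
  by_contra! H
  have H' : ∀ N, ∃ k, N ≤ k ∧ ∃ a, a ∈ U k ∧ a ∉ U N := fun N => by
    obtain ⟨k, hk, hne⟩ := H N
    exact ⟨k, hk, Set.not_subset.1 fun h => hne (h.antisymm (hmono hk))⟩
  choose l hl a ha ha' using H'
  let s : ℕ → ℕ := fun i => l^[i] 0
  have hs : ∀ i, s (i + 1) = l (s i) := fun i => Function.iterate_succ_apply' l i 0
  have hsm : Monotone s := monotone_nat_of_le_succ fun i => by rw [hs]; exact hl _
  obtain ⟨i, j, hij, hle⟩ := wellQuasiOrdered_le (α := α) fun i => a (s i)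
  refine ha' (s j) (hU _ hle (hmono (hsm hij) ?_))
  change a (s i) ∈ U (s (i + 1))
  rw [hs]
  exact ha _

open Finset in
theorem sum_antidiagonalTuple_succ {M : Type*} [AddCommMonoid M] (n d : ℕ)
    (g : (Fin (n + 1) → ℕ) → M) :
    ∑ a ∈ Nat.antidiagonalTuple (n + 1) d, g a =
      ∑ k ∈ range (d + 1), ∑ a ∈ Nat.antidiagonalTuple n (d - k), g (Fin.cons k a) := by
  rw [Finset.sum_sigma']
  refine (sum_bij' (fun x _ => Fin.cons x.1 x.2) (fun a _ => ⟨a 0, Fin.tail a⟩) ?_ ?_ ?_ ?_ ?_)|>.symm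
  · rintro ⟨k, a⟩ h
    simp only [mem_sigma, mem_range, Nat.mem_antidiagonalTuple] at h
    simp only [Nat.mem_antidiagonalTuple, Fin.sum_univ_succ, Fin.cons_zero, Fin.cons_succ]
    omega
  · intro a h
    simp only [Nat.mem_antidiagonalTuple, Fin.sum_univ_succ] at h
    simp only [mem_sigma, mem_range, Nat.mem_antidiagonalTuple, Fin.tail]
    omega
  · rintro ⟨k, a⟩ _
    simp
  · intro a _
    simp
  · intros
    rfl

open Filter Finset in
open scoped Classical in
/-- The number of tuples of sum `d` outside an upper set of `ℕ ^ n` is eventually polynomial. -/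
theorem exists_polynomial_eventually_eq_card_compl_isUpperSet (n : ℕ) (U : Set (Fin n → ℕ))
    (hU : IsUpperSet U) :
    ∃ P : Polynomial ℚ, ∀ᶠ d : ℕ in atTop,
      (∑ a ∈ Nat.antidiagonalTuple n d, if a ∈ U then (0 : ℚ) else 1) = P.eval (d : ℚ) := by
  induction n with
  | zero =>
    refine ⟨0, eventually_atTop.2 ⟨1, fun d hd => ?_⟩⟩
    obtain ⟨d, rfl⟩ := Nat.exists_eq_add_of_le' hd
    simp
  | succ n ih =>
    let S : ℕ → Set (Fin n → ℕ) := fun k => {a | Fin.cons k a ∈ U}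
    have hS : ∀ k, IsUpperSet (S k) := fun k a b hab ha =>
      hU (Fin.cons_le_cons.2 ⟨le_rfl, hab⟩) ha
    have hmono : Monotone S := fun k l hkl a ha => hU (Fin.cons_le_cons.2 ⟨hkl, le_rfl⟩) ha
    obtain ⟨N, hN⟩ := exists_forall_ge_eq_of_isUpperSet hS hmono
    let g : ℕ → ℕ → ℚ := fun k d => ∑ a ∈ Nat.antidiagonalTuple n d, if a ∈ S k then (0 : ℚ) else 1
    have hg : ∀ k, ∃ P : Polynomial ℚ, ∀ᶠ d : ℕ in atTop, g k (d - k) = P.eval (d : ℚ) :=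
      fun k => exists_polynomial_eventually_eq_shift (ih (S k) (hS k)).choose_spec k
    choose P hP using hg
    obtain ⟨Q, hQ⟩ := exists_polynomial_eventually_eq_sum_range (ih (S N) (hS N)).choose_spec
    obtain ⟨Q', hQ'⟩ := exists_polynomial_eventually_eq_shift
      (g := fun d => ∑ i ∈ range (d + 1), g N i) (P := Q.comp (Polynomial.X + 1))
      (((tendsto_add_atTop_nat 1).eventually hQ).mono fun d hd => by simpa [g] using hd) N
    refine ⟨∑ k ∈ range N, P k + Q', ?_⟩
    have hP' : ∀ᶠ d : ℕ in atTop, ∀ k ∈ range N, g k (d - k) = (P k).eval (d : ℚ) :=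
      (eventually_all_finset _).2 fun k _ => hP k
    filter_upwards [hP', hQ', eventually_ge_atTop N] with d h1 h2 hd
    rw [sum_antidiagonalTuple_succ, Polynomial.eval_add, Polynomial.eval_finsetSum, ← h2,
      ← sum_congr rfl h1, ← sum_range_add_sum_Ico _ (show N ≤ d + 1 by omega)]
    congr 1
    rw [← sum_range_reflect, sum_Ico_eq_sum_range, show d + 1 - N = d - N + 1 by omega]
    refine sum_congr rfl fun i hi => ?_
    rw [mem_range] at hi
    rw [show d - N + 1 - 1 - i = d - (N + i) by omega]
    simp only [g, ← hN (N + i) (by omega)]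
    rfl

theorem Submodule.finrank_map_add_finrank_inf_ker {K V W : Type*} [Field K] [AddCommGroup V]
    [Module K V] [AddCommGroup W] [Module K W] (g : V →ₗ[K] W) (p : Submodule K V)
    [FiniteDimensional K p] :
    Module.finrank K (p.map g) + Module.finrank K (p ⊓ LinearMap.ker g : Submodule K V) =
      Module.finrank K p := by
  rw [← LinearMap.finrank_range_add_finrank_ker (g.domRestrict p), LinearMap.range_domRestrict,
    LinearMap.ker_domRestrict, ← Submodule.map_comap_subtype,
    (Submodule.equivMapOfInjective _ p.injective_subtype _).finrank_eq]

section

variable {K : Type*} [Field K] {n : ℕ}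

instance finiteDimensional_homogeneousSubmodule (d : ℕ) :
    FiniteDimensional K (homogeneousSubmodule (Fin n) K d) :=
  Module.Finite.iff_fg.2 (homogeneousSubmodule_fg (Fin n) K d)

theorem hilbertFunctionQuotient_add_finrank (I : Ideal (MvPolynomial (Fin n) K)) (d : ℕ) :
    hilbertFunctionQuotient I d + Module.finrank K
      (homogeneousSubmodule (Fin n) K d ⊓ I.restrictScalars K : Submodule K _) =
      Module.finrank K (homogeneousSubmodule (Fin n) K d) := by
  have : LinearMap.ker (Ideal.Quotient.mkₐ K I).toLinearMap = I.restrictScalars K := by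
    ext x
    simp [Ideal.Quotient.eq_zero_iff_mem]
  rw [← this]
  exact Submodule.finrank_map_add_finrank_inf_ker _ _

theorem hilbertFunctionSubquotient_add_finrank {I J : Ideal (MvPolynomial (Fin n) K)}
    (hIJ : I ≤ J) (d : ℕ) :
    hilbertFunctionSubquotient J I d + Module.finrank K
      (homogeneousSubmodule (Fin n) K d ⊓ I.restrictScalars K : Submodule K _) =
      Module.finrank K
        (homogeneousSubmodule (Fin n) K d ⊓ J.restrictScalars K : Submodule K _) := by
  let ι : J →ₗ[K] MvPolynomial (Fin n) K := J.subtype.restrictScalars K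
  have hι : Function.Injective ι := J.injective_subtype
  let q : Submodule K J := (homogeneousSubmodule (Fin n) K d).comap ι
  have hq : q.map ι = homogeneousSubmodule (Fin n) K d ⊓ J.restrictScalars K := by
    ext x
    simp only [q, ι, Submodule.mem_map, Submodule.mem_comap, Submodule.mem_inf,
      LinearMap.coe_restrictScalars, Submodule.subtype_apply, Submodule.restrictScalars_mem]
    exact ⟨fun ⟨y, hy, h⟩ => h ▸ ⟨hy, y.2⟩, fun ⟨h, hJ⟩ => ⟨⟨x, hJ⟩, h, rfl⟩⟩
  have hk (y : J) : y ∈ LinearMap.ker ((I.submoduleOf J).mkQ.restrictScalars K) ↔ y.1 ∈ I := by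
    rw [LinearMap.mem_ker, LinearMap.restrictScalars_apply, Submodule.mkQ_apply,
      Submodule.Quotient.mk_eq_zero]
    rfl
  have hr : (q ⊓ LinearMap.ker ((I.submoduleOf J).mkQ.restrictScalars K)).map ι =
      homogeneousSubmodule (Fin n) K d ⊓ I.restrictScalars K := by
    ext x
    simp only [q, ι, Submodule.mem_map, Submodule.mem_comap, Submodule.mem_inf,
      LinearMap.coe_restrictScalars, Submodule.subtype_apply, Submodule.restrictScalars_mem, hk]
    exact ⟨fun ⟨y, hy, h⟩ => h ▸ hy, fun ⟨h, hI⟩ => ⟨⟨x, hIJ hI⟩, ⟨h, hI⟩, rfl⟩⟩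
  have hfd : FiniteDimensional K (q.map ι) := hq ▸ Submodule.finiteDimensional_inf_left _ _
  have : FiniteDimensional K q := Module.Finite.equiv (Submodule.equivMapOfInjective ι hι q).symm
  have := Submodule.finrank_map_add_finrank_inf_ker ((I.submoduleOf J).mkQ.restrictScalars K) q
  rw [← hr, ← hq, ← (Submodule.equivMapOfInjective ι hι q).finrank_eq,
    ← (Submodule.equivMapOfInjective ι hι _).finrank_eq]
  exact this

theorem hilbertFunctionQuotient_eq_add {I J : Ideal (MvPolynomial (Fin n) K)} (hIJ : I ≤ J)
    (d : ℕ) : hilbertFunctionQuotient I d =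
      hilbertFunctionSubquotient J I d + hilbertFunctionQuotient J d := by
  have h1 := hilbertFunctionQuotient_add_finrank I d
  have h2 := hilbertFunctionQuotient_add_finrank J d
  have h3 := hilbertFunctionSubquotient_add_finrank hIJ d
  omega

/-- The exponents of the leading monomials of the homogeneous elements of an ideal. -/
def leadingExponents (I : Ideal (MvPolynomial (Fin n) K)) : Set (Fin n →₀ ℕ) :=
  {a | ∃ g ∈ I, g ≠ 0 ∧ g.IsHomogeneous a.degree ∧ MonomialOrder.lex.degree g = a}

theorem isUpperSet_leadingExponents (I : Ideal (MvPolynomial (Fin n) K)) :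
    IsUpperSet (leadingExponents I) := by
  rintro a b hab ⟨g, hg, hg0, hgh, rfl⟩
  obtain ⟨c, rfl⟩ := exists_add_of_le hab
  have hc : monomial c (1 : K) ≠ 0 := by simp
  refine ⟨g * monomial c 1, I.mul_mem_right _ hg, mul_ne_zero hg0 hc, ?_, ?_⟩
  · rw [map_add]
    exact hgh.mul (isHomogeneous_monomial _ rfl)
  · rw [MonomialOrder.degree_mul hg0 hc]
    classical
    rw [MonomialOrder.degree_monomial, if_neg one_ne_zero]

/-- The exponents of degree `d` of the standard monomials of an ideal. -/
def standardExponents (I : Ideal (MvPolynomial (Fin n) K)) (d : ℕ) : Set (Fin n →₀ ℕ) :=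
  {a | a.degree = d ∧ a ∉ leadingExponents I}

theorem linearIndependent_standard (I : Ideal (MvPolynomial (Fin n) K)) (d : ℕ) :
    LinearIndependent K fun a : standardExponents I d =>
      Ideal.Quotient.mk I (monomial a.1 (1 : K)) := by
  rw [linearIndependent_iff]
  intro l hl
  by_contra hl0
  let p : MvPolynomial (Fin n) K := ∑ a ∈ l.support, monomial a.1 (l a)
  have hcoeff : ∀ a : standardExponents I d, p.coeff a.1 = l a := fun a => by
    classical
    simp only [p, coeff_sum, coeff_monomial, Subtype.coe_inj]
    simp [eq_comm]
  have hsupp : ∀ b ∈ p.support, b ∈ standardExponents I d := fun b hb => by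
    classical
    by_contra hb'
    refine mem_support_iff.1 hb ?_
    simp only [p, coeff_sum, coeff_monomial]
    exact Finset.sum_eq_zero fun a _ => if_neg fun h : a.1 = b => hb' (h ▸ a.2)
  have hp0 : p ≠ 0 := fun h => hl0 <| Finsupp.ext fun a => by
    rw [← hcoeff, h]; simp
  have hpI : p ∈ I := by
    rw [← Ideal.Quotient.eq_zero_iff_mem, ← hl, Finsupp.linearCombination_apply, Finsupp.sum,
      map_sum]
    refine Finset.sum_congr rfl fun a _ => ?_
    rw [← Ideal.Quotient.mkₐ_eq_mk K, ← map_smul, smul_monomial, smul_eq_mul, mul_one]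
  have hlead := hsupp _ ((MonomialOrder.lex.degree_mem_support_iff p).2 hp0)
  refine hlead.2 ⟨p, hpI, hp0, ?_, rfl⟩
  rw [hlead.1]
  intro b hb
  rw [Pi.one_def, ← Finsupp.degree_eq_weight_one]
  exact (hsupp b (mem_support_iff.2 hb)).1

theorem mk_monomial_mem_span_standard (I : Ideal (MvPolynomial (Fin n) K)) (d : ℕ)
    (a : Fin n →₀ ℕ) (ha : a.degree = d) :
    Ideal.Quotient.mk I (monomial a (1 : K)) ∈ Submodule.span K
      (Set.range fun a : standardExponents I d => Ideal.Quotient.mk I (monomial a.1 (1 : K))) := by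
  induction h : MonomialOrder.lex.toSyn a using WellFoundedLT.induction generalizing a with
  | _ s ih =>
    subst h
    by_cases hs : a ∈ leadingExponents I
    · obtain ⟨g, hg, hg0, hgh, hga⟩ := hs
      have hc : g.coeff a ≠ 0 := by
        rw [← hga]; exact MonomialOrder.lex.coeff_degree_ne_zero_iff.2 hg0
      have hmem : a ∈ g.support := mem_support_iff.2 hc
      have hsum : ∑ b ∈ g.support, g.coeff b • Ideal.Quotient.mk I (monomial b (1 : K)) = 0 := by
        rw [← Ideal.Quotient.eq_zero_iff_mem.2 hg]
        conv_rhs => rw [g.as_sum, map_sum]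
        refine Finset.sum_congr rfl fun b _ => ?_
        rw [← Ideal.Quotient.mkₐ_eq_mk K, ← map_smul, smul_monomial, smul_eq_mul, mul_one]
      rw [← Finset.add_sum_erase _ _ hmem, add_eq_zero_iff_eq_neg] at hsum
      rw [← Submodule.smul_mem_iff _ hc, hsum]
      refine Submodule.neg_mem _ (Submodule.sum_mem _ fun b hb => Submodule.smul_mem _ _ ?_)
      obtain ⟨hba, hb⟩ := Finset.mem_erase.1 hb
      refine ih _ (lt_of_le_of_ne ?_ ?_) b ?_ rfl
      · rw [← hga]; exact MonomialOrder.le_degree hb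
      · simpa using hba
      · rw [← ha]
        exact not_imp_comm.1 hgh.coeff_eq_zero (mem_support_iff.1 hb)
    · exact Submodule.subset_span ⟨⟨a, ha, hs⟩, rfl⟩

theorem quotientComponent_eq_span_standard (I : Ideal (MvPolynomial (Fin n) K)) (d : ℕ) :
    quotientComponent I d = Submodule.span K
      (Set.range fun a : standardExponents I d => Ideal.Quotient.mk I (monomial a.1 (1 : K))) := by
  apply le_antisymm
  · rintro _ ⟨p, hp, rfl⟩
    rw [p.as_sum, map_sum]
    refine Submodule.sum_mem _ fun b hb => ?_
    have : monomial b (p.coeff b) = p.coeff b • monomial b (1 : K) := by simp [smul_monomial]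
    rw [this, map_smul]
    refine Submodule.smul_mem _ _ (mk_monomial_mem_span_standard I d b ?_)
    exact not_imp_comm.1 (IsHomogeneous.coeff_eq_zero hp) (mem_support_iff.1 hb)
  · rw [Submodule.span_le]
    rintro _ ⟨a, rfl⟩
    exact ⟨monomial a.1 1, isHomogeneous_monomial _ a.2.1, rfl⟩

/-- Macaulay's theorem: the Hilbert function counts standard monomials. -/
theorem hilbertFunctionQuotient_eq_ncard (I : Ideal (MvPolynomial (Fin n) K)) (d : ℕ) :
    hilbertFunctionQuotient I d = (standardExponents I d).ncard := by
  rw [hilbertFunctionQuotient, quotientComponent_eq_span_standard, ← Nat.card_coe_set_eq]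
  exact Module.finrank_eq_nat_card_basis (Module.Basis.span (linearIndependent_standard I d))

open Filter Finset in
/-- The quotient of a polynomial ring by an ideal has a Hilbert polynomial. -/
theorem exists_isHilbertPolynomial_quotient (I : Ideal (MvPolynomial (Fin n) K)) :
    ∃ P, IsHilbertPolynomial (hilbertFunctionQuotient I) P := by
  classical
  let e : (Fin n →₀ ℕ) ≃ (Fin n → ℕ) := Finsupp.equivFunOnFinite
  obtain ⟨P, hP⟩ := exists_polynomial_eventually_eq_card_compl_isUpperSet n
    (e.symm ⁻¹' leadingExponents I)
    fun a b hab ha => isUpperSet_leadingExponents I (show e.symm a ≤ e.symm b from hab) ha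
  refine ⟨P, hP.mono fun d hd => ?_⟩
  rw [← hd, hilbertFunctionQuotient_eq_ncard, ← Set.ncard_image_of_injective _ e.injective]
  have : e '' standardExponents I d =
      ((Nat.antidiagonalTuple n d).filter fun a => a ∉ e.symm ⁻¹' leadingExponents I :
        Finset (Fin n → ℕ)) := by
    ext a
    obtain ⟨a, rfl⟩ := e.surjective a
    simp [standardExponents, Nat.mem_antidiagonalTuple, Finsupp.degree_eq_sum, e]
  rw [this, Set.ncard_coe_finset, card_filter]
  push_cast
  refine sum_congr rfl fun a _ => ?_
  split_ifs <;> simp_all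

theorem vinegarIdeal_eq (v : ℕ) :
    vinegarIdeal K n v = Ideal.span (X '' {j : Fin n | j.val < v}) := by
  rw [vinegarIdeal]
  congr 1
  ext p
  simp [eq_comm]

theorem mem_leadingExponents_vinegarIdeal {v : ℕ} {a : Fin n →₀ ℕ} :
    a ∈ leadingExponents (vinegarIdeal K n v) ↔ ∃ j : Fin n, j.val < v ∧ a j ≠ 0 := by
  constructor
  · rintro ⟨g, hg, hg0, -, rfl⟩
    rw [vinegarIdeal_eq, mem_ideal_span_X_image] at hg
    exact hg _ ((MonomialOrder.lex.degree_mem_support_iff g).2 hg0)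
  · intro h
    classical
    refine ⟨monomial a 1, ?_, by simp, isHomogeneous_monomial _ rfl, ?_⟩
    · rw [vinegarIdeal_eq, mem_ideal_span_X_image]
      intro b hb
      obtain rfl : b = a := by simpa using support_monomial_subset hb
      exact h
    · rw [MonomialOrder.degree_monomial, if_neg one_ne_zero]

/-- The Hilbert function of `R / V` agrees with a polynomial in every degree. -/
theorem hilbertFunctionQuotient_vinegarIdeal {v : ℕ} (hvn : v < n) (d : ℕ) :
    (hilbertFunctionQuotient (vinegarIdeal K n v) d : ℚ) =
      (Polynomial.preHilbertPoly ℚ (n - v - 1) 0).eval (d : ℚ) := by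
  rw [Polynomial.preHilbertPoly_eq_choose_sub_add ℚ _ (Nat.zero_le d),
    hilbertFunctionQuotient_eq_ncard]
  have : standardExponents (vinegarIdeal K n v) d =
      (({j | v ≤ j.val} : Finset (Fin n)).finsuppAntidiag d : Set (Fin n →₀ ℕ)) := by
    ext a
    simp only [standardExponents, mem_leadingExponents_vinegarIdeal, Set.mem_ofPred_eq,
      Finset.mem_coe, Finset.mem_finsuppAntidiag', Finsupp.degree_apply, Finset.subset_iff]
    simp [Finsupp.sum, not_imp_comm]
  rw [this, Set.ncard_coe_finset, Finset.card_finsuppAntidiag_nat_eq_choose]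
  have hcard : ({j | v ≤ j.val} : Finset (Fin n)).card = n - v := by
    have := Fin.card_filter_val_lt (n := n) (m := v)
    have h2 := Finset.card_filter_add_card_filter_not (s := (Finset.univ : Finset (Fin n)))
      (fun j => j.val < v)
    simp only [not_lt, Finset.card_univ, Fintype.card_fin] at h2
    omega
  rw [hcard, show n - v + d - 1 = d - 0 + (n - v - 1) by omega]
  norm_cast
  rw [Nat.choose_symm_of_eq_add]
  omega

theorem systemIdeal_le_vinegarIdeal {v m : ℕ} {f : Fin m → MvPolynomial (Fin n) K}
    (hf : IsHomogeneousOVSystem v f) : systemIdeal f ≤ vinegarIdeal K n v := by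
  rw [systemIdeal, Ideal.span_le]
  rintro _ ⟨k, rfl⟩
  obtain ⟨⟨α, β, γ, h⟩, hk⟩ := hf k
  have hq : (∑ i : Fin n, ∑ j : Fin n with j.val < v, C (α i j) * X i * X j :
      MvPolynomial (Fin n) K).IsHomogeneous 2 :=
    IsHomogeneous.sum _ _ _ fun i _ => IsHomogeneous.sum _ _ _ fun j _ =>
      (isHomogeneous_C_mul_X _ _).mul (isHomogeneous_X _ _)
  have hl : (∑ i : Fin n, C (β i) * X i : MvPolynomial (Fin n) K).IsHomogeneous 1 :=
    IsHomogeneous.sum _ _ _ fun i _ => isHomogeneous_C_mul_X _ _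
  have h2 := congrArg (homogeneousComponent 2) h
  rw [homogeneousComponent_of_mem hk, map_add, map_add, homogeneousComponent_of_mem hq,
    homogeneousComponent_of_mem hl, homogeneousComponent_of_mem (isHomogeneous_C _ γ)] at h2
  norm_num at h2
  rw [h2]
  refine Ideal.sum_mem _ fun i _ => Ideal.sum_mem _ fun j hj => Ideal.mul_mem_left _ _ ?_
  exact Ideal.subset_span ⟨j, (Finset.mem_filter.1 hj).2, rfl⟩

end

/-- Adding a polynomial function does not change the index of regularity. -/
theorem indexOfRegularity_eq_of_eq_add {H H' : ℕ → ℕ} {Q : Polynomial ℚ}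
    (h : ∀ d, (H d : ℚ) = H' d + Q.eval (d : ℚ)) : indexOfRegularity H = indexOfRegularity H' := by
  rw [indexOfRegularity, indexOfRegularity]
  congr 1
  ext d
  constructor
  · rintro ⟨P, hP, hd⟩
    refine ⟨P - Q, hP.mono fun e he => ?_, fun e he => ?_⟩
    · rw [Polynomial.eval_sub, ← he, h]; ring
    · rw [Polynomial.eval_sub, ← hd e he, h]; ring
  · rintro ⟨P, hP, hd⟩
    refine ⟨P + Q, hP.mono fun e he => ?_, fun e he => ?_⟩
    · rw [Polynomial.eval_add, ← he, h]
    · rw [Polynomial.eval_add, ← hd e he, h]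

theorem mainTheorem4 {K : Type*} [Field K] (n v m : ℕ) (hv : 0 < v) (hvn : v < n)
    (f : Fin m → MvPolynomial (Fin n) K) (hf : IsHomogeneousOVSystem v f) :
    (∃ P, IsHilbertPolynomial (hilbertFunctionQuotient (systemIdeal f)) P) ∧
    (∃ P, IsHilbertPolynomial
      (hilbertFunctionSubquotient (vinegarIdeal K n v) (systemIdeal f)) P) ∧
    indexOfRegularity (hilbertFunctionQuotient (systemIdeal f)) =
      indexOfRegularity
        (hilbertFunctionSubquotient (vinegarIdeal K n v) (systemIdeal f)) := by
  have h (d : ℕ) : (hilbertFunctionQuotient (systemIdeal f) d : ℚ) =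
      hilbertFunctionSubquotient (vinegarIdeal K n v) (systemIdeal f) d +
        (Polynomial.preHilbertPoly ℚ (n - v - 1) 0).eval (d : ℚ) := by
    rw [← hilbertFunctionQuotient_vinegarIdeal (K := K) hvn,
      hilbertFunctionQuotient_eq_add (systemIdeal_le_vinegarIdeal hf)]
    push_cast
    rfl
  obtain ⟨P, hP⟩ := exists_isHilbertPolynomial_quotient (systemIdeal f)
  refine ⟨⟨P, hP⟩, ⟨P - Polynomial.preHilbertPoly ℚ (n - v - 1) 0, hP.mono fun d hd => ?_⟩,
    indexOfRegularity_eq_of_eq_add h⟩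
  rw [Polynomial.eval_sub, ← hd, h]
  ring
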